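/- Let $n\ge 0$ and let $D$ be a digraph with vertex set $[n]=\{1,\dots,n\}$, without loops or multiple edges (edges $(a,b)$ and $(b,a)$ may both be present), and connected in the sense that its underlying undirected graph is connected or empty. For an edge $(a,b)$ of $D$ let $(a\to b)$ be the transformation of $[n]$ that maps $a$ to $b$ and fixes every other vertex, and let $\langle D\rangle$ be the semigroup of transformations generated by all $(a\to b)$ with $(a,b)\in E(D)$. For $\alpha\in\langle D\rangle$ let $\ell(D,\alpha)$ be the minimal length of a word in these arcs whose product is $\alpha$, and let $\mathrm{fix}(\alpha)$ be the number of fixed points of $\alpha$. Then the following are equivalent. (i) $\ell(D,\alpha)=n-\mathrm{fix}(\alpha)$ for all $\alpha\in\langle D\rangle$. (ii) $D$ is closed and satisfies both $(\star)$ and $(\star\star)$. Here $D$ is *closed* if, whenever an edge $(b,a)$ of $D$ lies in a directed cycle of $D$, $(a,b)$ is also an edge of $D$. With $d_D(u,v)$ the length of a shortest directed path from $u$ to $v$ and $N^+(C)=\{w : (c,w)\in E(D)\text{ for some }c\in C\}$, the properties are: $(\star)$ if $d_D(v_0,v_2)=2$ and $v_0,v_1,v_2$ is a directed path in $D$, then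 $N^+(\{v_1,v_2\})\subseteq\{v_0,v_1,v_2\}$; $(\star\star)$ for every strong component $C$ of $D$, $|C|\le 2$ if $C$ is nonterminal, and $|C|\le 3$ if $C$ is terminal (that is, if no edge of $D$ leaves $C$). -/

import Mathlib

namespace ArcSemigroup

variable {V : Type*}

/-- A digraph is simple if it has no loops. (Multiple edges are impossible in `Digraph V`;
edges in both directions between two vertices are allowed.) -/
def IsSimple (D : Digraph V) : Prop := ∀ v, ¬ D.Adj v v

/-- A digraph is connected if its underlying undirected graph is: any two vertices are joined by
a sequence of edges, each traversed in either direction. -/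
def IsConnected (D : Digraph V) : Prop :=
  ∀ u v, Relation.ReflTransGen (fun x y => D.Adj x y ∨ D.Adj y x) u v

/-! ### Arcs, the generated semigroup, words and length -/

/-- The arc `a → b`: the transformation mapping `a` to `b` and fixing all other points. -/
def arc [DecidableEq V] (a b : V) : Function.End V := fun x => if x = a then b else x

/-- The semigroup `⟨D⟩` generated by the arcs `a → b` with `(a, b)` an edge of `D`.
(As a set of transformations it does not depend on whether maps are composed from the
left or from the right.) -/
def arcSemigroup [DecidableEq V] (D : Digraph V) : Subsemigroup (Function.End V) :=
  Subsemigroup.closure {f | ∃ a b, D.Adj a b ∧ f = arc a b}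

/-- A word over the edge set of `D`, i.e. an element of the free monoid `D^*`. -/
def IsWord (D : Digraph V) (w : List (V × V)) : Prop := ∀ e ∈ w, D.Adj e.1 e.2

/-- Evaluation of a word; transformations act on the right, so the first letter acts first. -/
def evalWord [DecidableEq V] : List (V × V) → Function.End V
  | [] => fun x => x
  | e :: w => fun x => evalWord w (arc e.1 e.2 x)

/-- `ℓ(D, α)`: the minimal length of a word over the edges of `D` expressing `α`. -/
noncomputable def wordLength [DecidableEq V] (D : Digraph V) (α : Function.End V) : ℕ :=
  sInf {k | ∃ w : List (V × V), IsWord D w ∧ evalWord w = α ∧ w.length = k}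

/-- `fix(α)`: the number of fixed points. -/
noncomputable def fix (α : Function.End V) : ℕ := {x : V | α x = x}.ncard

/-! ### Closed digraphs -/

/-- The edge `(u, v)` lies on the directed cycle `c 0, c 1, …, c k, c 0` of `D`
(`k ≥ 1`, distinct vertices); addition in `Fin (k + 1)` is cyclic. -/
def InDirectedCycle (D : Digraph V) (u v : V) : Prop :=
  ∃ k : ℕ, 1 ≤ k ∧ ∃ c : Fin (k + 1) → V, Function.Injective c ∧
    (∀ i, D.Adj (c i) (c (i + 1))) ∧ ∃ i, c i = u ∧ c (i + 1) = v

/-- The closure of `D`: add `(a, b)` whenever `(b, a)` is an edge in a directed cycle of `D`. -/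
def closure (D : Digraph V) : Digraph V where
  Adj a b := D.Adj a b ∨ (D.Adj b a ∧ InDirectedCycle D b a)

/-- `D` is closed if it equals its closure. -/
def IsClosed (D : Digraph V) : Prop := D = closure D

/-! ### Directed paths, distance, and property `(⋆)` -/

/-- A directed path, as the list of its (distinct) vertices. Its length is the number of edges,
`p.length - 1`. -/
def IsDirectedPath (D : Digraph V) (p : List V) : Prop :=
  p ≠ [] ∧ p.Nodup ∧ p.IsChain D.Adj

/-- `d_D(u, v)`: the length of a shortest directed path from `u` to `v`, and `⊤` if there is
none. -/
noncomputable def dist (D : Digraph V) (u v : V) : ℕ∞ :=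
  sInf {d | ∃ p : List V, IsDirectedPath D p ∧ p.head? = some u ∧ p.getLast? = some v ∧
    d = ((p.length - 1 : ℕ) : ℕ∞)}

/-- The out-neighbourhood `N⁺(C)` of a set of vertices. -/
def outNeighbours (D : Digraph V) (C : Set V) : Set V := {w | ∃ c ∈ C, D.Adj c w}

/-- Property `(⋆)`. -/
def Star (D : Digraph V) : Prop :=
  ∀ v₀ v₁ v₂ : V, dist D v₀ v₂ = 2 → IsDirectedPath D [v₀, v₁, v₂] →
    outNeighbours D {v₁, v₂} ⊆ {v₀, v₁, v₂}

/-! ### Strong components and property `(⋆⋆)` -/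

/-- `C` is a strong component of `D`: a class of mutual reachability by directed paths. -/
def IsStrongComponent (D : Digraph V) (C : Set V) : Prop :=
  ∃ v, C = {u | Relation.ReflTransGen D.Adj v u ∧ Relation.ReflTransGen D.Adj u v}

/-- `C₁` connects to `C₂` if some edge of `D` goes from `C₁` to `C₂`. -/
def Connects (D : Digraph V) (C₁ C₂ : Set V) : Prop := ∃ u ∈ C₁, ∃ v ∈ C₂, D.Adj u v

/-- A strong component is terminal if it connects to no other strong component. -/
def IsTerminal (D : Digraph V) (C : Set V) : Prop :=
  ¬ ∃ C' : Set V, IsStrongComponent D C' ∧ C' ≠ C ∧ Connects D C C'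

/-- Property `(⋆⋆)`. -/
def StarStar (D : Digraph V) : Prop :=
  ∀ C : Set V, IsStrongComponent D C →
    (¬ IsTerminal D C → C.ncard ≤ 2) ∧ (IsTerminal D C → C.ncard ≤ 3)

end ArcSemigroup

namespace ArcSemigroup

/-! ### Words -/

section Words

variable {V : Type*} [DecidableEq V]

/-! A word fixes every point that is not the source of one of its letters. So the number of moved
points, `n - fix(α)`, bounds the length from below, and equality forces pairwise distinct sources.
In a word with distinct sources a moved point `x` has exactly one letter `(x, y)`, and `x` either
stops at `y`, vacated earlier, or ends where `y` ends (`evalWord_letter`).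

Necessity: if a condition fails, some product of arcs has no such word. Either it sends a point to a
vertex that is not an out-neighbour, while no out-neighbour has the same image, or it swaps two
points whose images are shared by no third point (`not_swap_of_nodup`).

Sufficiency: under the structural conditions, a point sent by `α` to distance two has an
out-neighbour with the same image (`respectsDistTwo_evalWord`). Such points, and swapped points with
a similar partner, are first merged into that neighbour (`IsDetour`). All other moved points then
travel along a single edge. This costs one letter per moved point, provided the direct moves contain
no cycle. A cycle would lie in a strong component with at most three points, which `α` cannot
permute nontrivially. It would thus be a swap in a terminal component of three points, and the third
point, sharing the image of one swapped point, makes that point a detour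
(`exists_notMem_of_not_isDetour`). -/

theorem arc_self (a b : V) : arc a b a = b := by simp [arc]

theorem arc_of_ne {a b x : V} (h : x ≠ a) : arc a b x = x := by simp [arc, h]

theorem evalWord_cons (e : V × V) (w : List (V × V)) (x : V) :
    evalWord (e :: w) x = evalWord w (arc e.1 e.2 x) := rfl

theorem evalWord_append (w₁ w₂ : List (V × V)) (x : V) :
    evalWord (w₁ ++ w₂) x = evalWord w₂ (evalWord w₁ x) := by
  induction w₁ generalizing x with
  | nil => rfl
  | cons e w ih => simp only [List.cons_append, evalWord_cons, ih]

theorem evalWord_of_notMem {w : List (V × V)} {x : V} (h : x ∉ w.map Prod.fst) :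
    evalWord w x = x := by
  induction w with
  | nil => rfl
  | cons e w ih =>
    simp only [List.map_cons, List.mem_cons, not_or] at h
    rw [evalWord_cons, arc_of_ne h.1, ih h.2]

/-- The empty word is excluded because `⟨D⟩` is generated as a semigroup, not as a monoid. -/
theorem evalWord_mem {D : Digraph V} {w : List (V × V)} (hw : IsWord D w) (hne : w ≠ []) :
    evalWord w ∈ arcSemigroup D := by
  induction w with
  | nil => exact absurd rfl hne
  | cons e w ih =>
    have he : arc e.1 e.2 ∈ arcSemigroup D :=
      Subsemigroup.subset_closure ⟨e.1, e.2, hw e (by simp), rfl⟩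
    rcases eq_or_ne w [] with rfl | hw'
    · exact he
    · exact mul_mem (ih (fun f hf => hw f (by simp [hf])) hw') he

theorem exists_word {D : Digraph V} {α : Function.End V} (hα : α ∈ arcSemigroup D) :
    ∃ w, IsWord D w ∧ evalWord w = α := by
  induction hα using Subsemigroup.closure_induction with
  | mem f hf =>
    obtain ⟨a, b, hab, rfl⟩ := hf
    exact ⟨[(a, b)], by simpa [IsWord] using hab, rfl⟩
  | mul f g _ _ hf hg =>
    obtain ⟨u, hu, rfl⟩ := hf
    obtain ⟨v, hv, rfl⟩ := hg
    -- The product `f * g` in `Function.End` applies `g` first, as the first letters of a word do.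
    refine ⟨v ++ u, ?_, ?_⟩
    · intro e he
      rcases List.mem_append.1 he with h | h
      exacts [hv e h, hu e h]
    · funext x
      exact evalWord_append v u x

omit [DecidableEq V] in
theorem fix_add_ncard_moved [Fintype V] (α : Function.End V) :
    fix α + {x | α x ≠ x}.ncard = Fintype.card V := by
  have h := Set.ncard_add_ncard_compl {x : V | α x = x}
  rwa [Nat.card_eq_fintype_card] at h

theorem moved_subset_sources (w : List (V × V)) :
    {x | evalWord w x ≠ x} ⊆ ((w.map Prod.fst).toFinset : Set V) := by
  intro x hx
  by_contra h
  exact hx (evalWord_of_notMem (by simpa using h))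

theorem ncard_moved_le_length (w : List (V × V)) :
    {x | evalWord w x ≠ x}.ncard ≤ w.length := by
  refine (Set.ncard_le_ncard (moved_subset_sources w)).trans ?_
  rw [Set.ncard_coe_finset]
  exact (List.toFinset_card_le _).trans (by simp)

/-- Every moved point is a source, so a repeated source would make the word longer than the number
of moved points. -/
theorem nodup_sources_of_length_eq {w : List (V × V)}
    (h : w.length = {x | evalWord w x ≠ x}.ncard) : (w.map Prod.fst).Nodup := by
  have h1 := Set.ncard_le_ncard (moved_subset_sources w)
  rw [Set.ncard_coe_finset, ← h] at h1
  have h2 := List.toFinset_card_le (w.map Prod.fst)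
  rw [List.length_map] at h2
  rw [List.card_toFinset] at h1 h2
  have h3 : (w.map Prod.fst).dedup.length = (w.map Prod.fst).length := by
    rw [List.length_map]; exact le_antisymm h2 h1
  rw [← List.dedup_eq_self]
  exact (List.dedup_sublist _).eq_of_length h3

/-- In a word whose letters have distinct sources, a point moved by the letter `(x, y)` either
stops at `y`, which has been vacated, or joins `y`. -/
theorem evalWord_letter {w₁ w₂ : List (V × V)} {x y : V}
    (h : ((w₁ ++ (x, y) :: w₂).map Prod.fst).Nodup) (hxy : x ≠ y) :
    (y ∈ w₁.map Prod.fst ∧ evalWord (w₁ ++ (x, y) :: w₂) x = y) ∨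
      evalWord (w₁ ++ (x, y) :: w₂) x = evalWord (w₁ ++ (x, y) :: w₂) y := by
  rw [List.map_append, List.map_cons, List.nodup_append'] at h
  obtain ⟨-, h2, h3⟩ := h
  have hx : x ∉ w₁.map Prod.fst := fun hx => h3 hx (by simp)
  have ex : evalWord (w₁ ++ (x, y) :: w₂) x = evalWord w₂ y := by
    rw [evalWord_append, evalWord_of_notMem hx, evalWord_cons, arc_self]
  by_cases hy : y ∈ w₁.map Prod.fst
  · have hy2 : y ∉ w₂.map Prod.fst := fun hy2 => h3 hy (by simp only [List.mem_cons, hy2, or_true])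
    exact Or.inl ⟨hy, by rw [ex, evalWord_of_notMem hy2]⟩
  · right
    rw [ex, evalWord_append, evalWord_of_notMem hy, evalWord_cons, arc_of_ne hxy.symm]

omit [DecidableEq V] in
theorem exists_split_of_mem_sources {w : List (V × V)} {x : V} (h : x ∈ w.map Prod.fst) :
    ∃ w₁ y w₂, w = w₁ ++ (x, y) :: w₂ := by
  obtain ⟨⟨a, y⟩, he, rfl⟩ := List.mem_map.1 h
  obtain ⟨w₁, w₂, rfl⟩ := List.append_of_mem he
  exact ⟨w₁, y, w₂, rfl⟩

theorem exists_split_of_moved {w : List (V × V)} {x : V} (h : evalWord w x ≠ x) :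
    ∃ w₁ y w₂, w = w₁ ++ (x, y) :: w₂ :=
  exists_split_of_mem_sources (by by_contra hx; exact h (evalWord_of_notMem hx))

theorem exists_adj_of_moved {D : Digraph V} (hs : IsSimple D) {w : List (V × V)} (hw : IsWord D w)
    (hn : (w.map Prod.fst).Nodup) {x : V} (h : evalWord w x ≠ x) :
    ∃ y, D.Adj x y ∧ (evalWord w x = y ∨ evalWord w x = evalWord w y) := by
  obtain ⟨w₁, y, w₂, rfl⟩ := exists_split_of_moved h
  have hxy : D.Adj x y := hw (x, y) (by simp)
  have hne : x ≠ y := by rintro rfl; exact hs _ hxy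
  exact ⟨y, hxy, (evalWord_letter hn hne).imp And.right id⟩

/-- As nothing else ends at `b` or `c`, neither point can join a third one. So `b` moves straight to
`c` after `c` has left, and `c` straight to `b` after `b` has left, which is contradictory. -/
theorem not_swap_of_nodup {D : Digraph V} (hs : IsSimple D) {w : List (V × V)} (hw : IsWord D w)
    (hn : (w.map Prod.fst).Nodup) {b c : V} (hbc : b ≠ c) (hb : ∀ y, evalWord w y = c → y = b)
    (hc : ∀ y, evalWord w y = b → y = c) (eb : evalWord w b = c) (ec : evalWord w c = b) :
    False := by
  obtain ⟨w₁, y, w₂, rfl⟩ := exists_split_of_moved (w := w) (x := b) (by rw [eb]; exact hbc.symm)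
  have hby : b ≠ y := by rintro rfl; exact hs _ (hw (b, b) (by simp))
  rcases evalWord_letter hn hby with ⟨h1, h2⟩ | h
  swap
  · exact hby (hb y (by rw [← h, eb])).symm
  rw [eb] at h2
  subst h2
  obtain ⟨w₃, z, w₄, rfl⟩ := exists_split_of_mem_sources h1
  have hcz : c ≠ z := by rintro rfl; exact hs _ (hw (c, c) (by simp))
  have e : (w₃ ++ (c, z) :: w₄) ++ (b, c) :: w₂ = w₃ ++ (c, z) :: (w₄ ++ (b, c) :: w₂) := by simp
  rw [e] at hn ec hc
  rcases evalWord_letter hn hcz with ⟨h1, h2⟩ | h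
  swap
  · exact hcz (hc z (by rw [← h, ec])).symm
  rw [ec] at h2
  subst h2
  rw [List.map_append, List.nodup_append'] at hn
  exact hn.2.2 h1 (by simp)

/-- Every element of the semigroup is expressed by a word of length the number of moved points. -/
def HasShortWords (D : Digraph V) : Prop :=
  ∀ α ∈ arcSemigroup D, ∃ w, IsWord D w ∧ evalWord w = α ∧ w.length = {x | α x ≠ x}.ncard

theorem wordLength_eq_iff [Fintype V] (D : Digraph V) :
    (∀ α ∈ arcSemigroup D, (wordLength D α : ℤ) = (Fintype.card V : ℤ) - (fix α : ℤ)) ↔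
      HasShortWords D := by
  refine forall₂_congr fun α hα => ?_
  have hf := fix_add_ncard_moved α
  have key : (wordLength D α : ℤ) = (Fintype.card V : ℤ) - (fix α : ℤ) ↔
      wordLength D α = {x | α x ≠ x}.ncard := by omega
  rw [key]
  constructor
  · intro h
    obtain ⟨w, hw, e⟩ := exists_word hα
    have hmem : wordLength D α ∈ {k | ∃ w, IsWord D w ∧ evalWord w = α ∧ w.length = k} :=
      -- The infimum is attained because some word expresses `α`; for an empty set it would be the
      -- default `0`.
      Nat.sInf_mem ⟨_, w, hw, e, rfl⟩
    obtain ⟨v, hv, ev, hl⟩ := hmem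
    exact ⟨v, hv, ev, hl.trans h⟩
  · rintro ⟨w, hw, e, hl⟩
    refine le_antisymm (hl ▸ Nat.sInf_le ⟨w, hw, e, rfl⟩) ?_
    refine le_csInf ⟨_, w, hw, e, rfl⟩ ?_
    rintro k ⟨v, -, rfl, rfl⟩
    exact ncard_moved_le_length v

theorem HasShortWords.exists_nodup {D : Digraph V} (h : HasShortWords D) {v : List (V × V)}
    (hv : IsWord D v) (hne : v ≠ []) :
    ∃ w, IsWord D w ∧ (w.map Prod.fst).Nodup ∧ evalWord w = evalWord v := by
  obtain ⟨w, hw, e, hl⟩ := h _ (evalWord_mem hv hne)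
  exact ⟨w, hw, nodup_sources_of_length_eq (by rw [e]; exact hl), e⟩

end Words

/-! ### Distance two, reachability and closedness -/

section Structure

variable {V : Type*} {D : Digraph V}

theorem dist_le_of_path {u v : V} {p : List V} (hp : IsDirectedPath D p) (hu : p.head? = some u)
    (hv : p.getLast? = some v) : dist D u v ≤ ((p.length - 1 : ℕ) : ℕ∞) :=
  sInf_le ⟨p, hp, hu, hv, rfl⟩

theorem dist_eq_two_iff {u m v : V} (hp : IsDirectedPath D [u, m, v]) :
    dist D u v = 2 ↔ ¬ D.Adj u v := by
  have huv : u ≠ v := by have := hp.2.1; simp at this; tauto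
  constructor
  · intro h hadj
    have := dist_le_of_path (D := D) (u := u) (v := v) (p := [u, v])
      ⟨by simp, by simpa using huv, by simpa using hadj⟩ rfl rfl
    rw [h] at this
    norm_num at this
  · intro h
    refine le_antisymm (dist_le_of_path hp rfl rfl) ?_
    refine le_sInf ?_
    rintro d ⟨p, hp', hu, hv, rfl⟩
    match p with
    | [] => simp at hu
    | [x] => simp at hu hv; exact absurd (hu.symm.trans hv) huv
    | [x, y] =>
      simp at hu hv
      subst hu hv
      exact absurd (by simpa using hp'.2.2) h
    | x :: y :: z :: l =>
      simp only [List.length_cons]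
      have : 2 ≤ l.length + 1 + 1 + 1 - 1 := by omega
      exact_mod_cast this

/-- Property `(⋆)` in terms of edges. -/
def EdgeStar (D : Digraph V) : Prop :=
  ∀ u m v w : V, D.Adj u m → D.Adj m v → u ≠ v → ¬ D.Adj u v → (D.Adj m w ∨ D.Adj v w) →
    w = u ∨ w = m ∨ w = v

theorem isDirectedPath_three (hs : IsSimple D) {u m v : V} (hum : D.Adj u m) (hmv : D.Adj m v)
    (huv : u ≠ v) : IsDirectedPath D [u, m, v] := by
  have h1 : u ≠ m := by rintro rfl; exact hs _ hum
  have h2 : m ≠ v := by rintro rfl; exact hs _ hmv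
  exact ⟨by simp, by simp [h1, h2, huv], by simp [hum, hmv]⟩

theorem star_iff_edgeStar (hs : IsSimple D) : Star D ↔ EdgeStar D := by
  constructor
  · intro h u m v w hum hmv huv hn hw
    have hp := isDirectedPath_three hs hum hmv huv
    have hw' : w ∈ outNeighbours D {m, v} := by
      rcases hw with hw | hw
      exacts [⟨m, by simp, hw⟩, ⟨v, by simp, hw⟩]
    simpa using h u m v ((dist_eq_two_iff hp).2 hn) hp hw'
  · rintro h u m v hd hp w ⟨c, hc, hw⟩
    have hch : D.Adj u m ∧ D.Adj m v := by simpa using hp.2.2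
    have huv : u ≠ v := by have := hp.2.1; simp at this; tauto
    have : D.Adj m w ∨ D.Adj v w := by
      rcases hc with rfl | hc
      · exact Or.inl hw
      · rw [Set.mem_singleton_iff] at hc; subst hc; exact Or.inr hw
    simpa using h u m v w hch.1 hch.2 huv ((dist_eq_two_iff hp).1 hd) this

/-- A path leaving the end `y` of a distance-two path `u, m, y` can only go back to `u` or `m`, so
no distance exceeds two. -/
theorem EdgeStar.reach_le_two (h : EdgeStar D) {u v : V} (huv : Relation.ReflTransGen D.Adj u v) :
    u = v ∨ D.Adj u v ∨ (u ≠ v ∧ ¬ D.Adj u v ∧ ∃ m, D.Adj u m ∧ D.Adj m v) := by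
  induction huv with
  | refl => exact Or.inl rfl
  | @tail y z _ hyz ih =>
    by_cases h1 : u = z
    · exact Or.inl h1
    by_cases h2 : D.Adj u z
    · exact Or.inr (Or.inl h2)
    refine Or.inr (Or.inr ⟨h1, h2, ?_⟩)
    rcases ih with rfl | hy | ⟨hne, hn, m, hum, hmy⟩
    · exact absurd hyz h2
    · exact ⟨y, hy, hyz⟩
    · rcases h u m y z hum hmy hne hn (Or.inr hyz) with rfl | rfl | rfl
      · exact absurd rfl h1
      · exact absurd hum h2
      · exact ⟨m, hum, hmy⟩

/-! ### Closedness as symmetry inside strong components -/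

theorem InDirectedCycle.reach {u v : V} (h : InDirectedCycle D u v) :
    Relation.ReflTransGen D.Adj v u := by
  obtain ⟨k, -, c, -, hc, i, rfl, rfl⟩ := h
  have from_zero : ∀ y, Relation.ReflTransGen D.Adj (c 0) (c y) := by
    intro y
    induction y using Fin.induction with
    | zero => exact .refl
    | succ y ih =>
      refine ih.tail ?_
      rw [← Fin.coeSucc_eq_succ]
      exact hc _
  have to_zero : ∀ x, Relation.ReflTransGen D.Adj (c x) (c 0) := by
    intro x
    induction x using Fin.reverseInduction with
    | last =>
      refine .single ?_
      have := hc (Fin.last k)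
      rwa [Fin.last_add_one] at this
    | cast x ih =>
      refine Relation.ReflTransGen.head ?_ ih
      rw [← Fin.coeSucc_eq_succ]
      exact hc _
  exact (to_zero _).trans (from_zero _)

theorem inDirectedCycle_three (hs : IsSimple D) {u v m : V} (h1 : D.Adj u v) (h2 : D.Adj v m)
    (h3 : D.Adj m u) : InDirectedCycle D u v := by
  have n1 : u ≠ v := by rintro rfl; exact hs _ h1
  have n2 : v ≠ m := by rintro rfl; exact hs _ h2
  have n3 : m ≠ u := by rintro rfl; exact hs _ h3
  refine ⟨2, by norm_num, ![u, v, m], ?_, ?_, 0, rfl, rfl⟩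
  · intro i j hij
    fin_cases i <;> fin_cases j <;> simp_all
  · intro i
    fin_cases i
    exacts [h1, h2, h3]

/-- Edges inside strong components are bidirectional. -/
def SymmetricInComponents (D : Digraph V) : Prop :=
  ∀ u v, D.Adj u v → Relation.ReflTransGen D.Adj v u → D.Adj v u

/-- Since distances are at most two, an edge inside a component that is not already reversed lies on
a directed triangle. -/
theorem IsClosed.symmetricInComponents (hs : IsSimple D) (hst : EdgeStar D) (h : IsClosed D) :
    SymmetricInComponents D := by
  intro u v huv hvu
  rcases hst.reach_le_two hvu with rfl | h1 | ⟨-, -, m, hvm, hmu⟩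
  · exact huv
  · exact h1
  · have : (closure D).Adj v u := Or.inr ⟨huv, inDirectedCycle_three hs huv hvm hmu⟩
    rwa [← h] at this

theorem SymmetricInComponents.isClosed (h : SymmetricInComponents D) : IsClosed D := by
  have key : ∀ a b, D.Adj a b ↔ (closure D).Adj a b := fun a b =>
    ⟨Or.inl, fun hab => hab.elim id fun ⟨hba, hcyc⟩ => h b a hba hcyc.reach⟩
  unfold IsClosed
  ext a b
  exact key a b

/-! ### Strong and terminal components -/

theorem reach_trans_mem {v x y : V}
    (hx : x ∈ {u | Relation.ReflTransGen D.Adj v u ∧ Relation.ReflTransGen D.Adj u v})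
    (hxy : Relation.ReflTransGen D.Adj x y) (hyx : Relation.ReflTransGen D.Adj y x) :
    y ∈ {u | Relation.ReflTransGen D.Adj v u ∧ Relation.ReflTransGen D.Adj u v} :=
  ⟨hx.1.trans hxy, hyx.trans hx.2⟩

theorem IsStrongComponent.reach {C : Set V} (hC : IsStrongComponent D C) {x y : V} (hx : x ∈ C)
    (hy : y ∈ C) : Relation.ReflTransGen D.Adj x y := by
  obtain ⟨v, rfl⟩ := hC
  exact hx.2.trans hy.1

theorem IsStrongComponent.mem_of_reach {C : Set V} (hC : IsStrongComponent D C) {x y : V}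
    (hx : x ∈ C) (hxy : Relation.ReflTransGen D.Adj x y) (hyx : Relation.ReflTransGen D.Adj y x) :
    y ∈ C := by
  obtain ⟨v, rfl⟩ := hC
  exact reach_trans_mem hx hxy hyx

theorem IsStrongComponent.eq_of_mem {C C' : Set V} (hC : IsStrongComponent D C)
    (hC' : IsStrongComponent D C') {x : V} (hx : x ∈ C) (hx' : x ∈ C') : C = C' := by
  ext y
  exact ⟨fun hy => hC'.mem_of_reach hx' (hC.reach hx hy) (hC.reach hy hx),
    fun hy => hC.mem_of_reach hx (hC'.reach hx' hy) (hC'.reach hy hx')⟩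

theorem IsTerminal.mem_of_adj {C : Set V} (hT : IsTerminal D C)
    {x y : V} (hx : x ∈ C) (hxy : D.Adj x y) : y ∈ C := by
  by_contra hy
  refine hT ⟨_, ⟨y, rfl⟩, ?_, x, hx, y, ⟨.refl, .refl⟩, hxy⟩
  intro h
  exact hy (h ▸ ⟨.refl, .refl⟩)

theorem IsTerminal.mem_of_reach {C : Set V} (hT : IsTerminal D C)
    {x y : V} (hx : x ∈ C) (hxy : Relation.ReflTransGen D.Adj x y) : y ∈ C := by
  induction hxy with
  | refl => exact hx
  | tail _ h ih => exact hT.mem_of_adj ih h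

end Structure

/-! ### Short words force the structure -/

section Necessity

variable {V : Type*} [DecidableEq V] {D : Digraph V}

theorem HasShortWords.edgeStar (hs : IsSimple D) (h : HasShortWords D) : EdgeStar D := by
  intro u m v w hum hmv huv hn hw
  by_contra! hcon
  obtain ⟨hwu, hwm, hwv⟩ := hcon
  have n1 : u ≠ m := by rintro rfl; exact hs _ hum
  have n2 : m ≠ v := by rintro rfl; exact hs _ hmv
  have key : ∀ α : List (V × V), IsWord D α → α ≠ [] → evalWord α u = v → evalWord α m = w →
      (∀ y, y ≠ u → y ≠ m → y ≠ v → evalWord α y = y) → False := by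
    intro α hα hne eu em ef
    obtain ⟨β, hβ, hnd, e⟩ := h.exists_nodup hα hne
    obtain ⟨y, huy, hy⟩ := exists_adj_of_moved hs hβ hnd (x := u) (by rw [e, eu]; exact huv.symm)
    rw [e, eu] at hy
    have hyv : y ≠ v := by rintro rfl; exact hn huy
    have hyu : y ≠ u := by rintro rfl; exact hs _ huy
    rcases hy with hy | hy
    · exact hyv hy.symm
    · by_cases hym : y = m
      · rw [hym, em] at hy; exact hwv hy.symm
      · rw [ef y hyu hym hyv] at hy; exact hyv hy.symm
  -- First `m` is cleared away to `w`, directly or through `v`; then `u` passes through `m` to `v`.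
  rcases hw with hw | hw
  · refine key [(m, w), (u, m), (m, v)] ?_ (by simp) ?_ ?_ ?_
    · simp [IsWord, hw, hum, hmv]
    · simp [evalWord, arc, n1]
    · simp [evalWord, arc, hwu, hwm]
    · intro y h1 h2 h3; simp [evalWord, arc, h1, h2]
  · refine key [(m, v), (v, w), (u, m), (m, v)] ?_ (by simp) ?_ ?_ ?_
    · simp [IsWord, hw, hum, hmv]
    · simp [evalWord, arc, n1, huv]
    · simp [evalWord, arc, hwu, hwm]
    · intro y h1 h2 h3; simp [evalWord, arc, h1, h2, h3]

theorem HasShortWords.adj_of_three_cycle (hs : IsSimple D) (h : HasShortWords D) {a b c : V}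
    (hac : D.Adj a c) (hcb : D.Adj c b) (hba : D.Adj b a) : D.Adj a b := by
  have n1 : a ≠ c := by rintro rfl; exact hs _ hac
  have n2 : c ≠ b := by rintro rfl; exact hs _ hcb
  have n3 : b ≠ a := by rintro rfl; exact hs _ hba
  -- Two rounds of the triangle: `b` and `c` each go once around and return, while `a` advances two
  -- steps, to `b`.
  set α : List (V × V) := [(b, a), (c, b), (a, c), (b, a), (c, b), (a, c)] with hα
  have ea : evalWord α a = b := by
    simp [α, evalWord, arc, n1, n2, n3]
  have ef : ∀ y, y ≠ a → evalWord α y = y := by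
    intro y hy
    by_cases hyb : y = b
    · subst hyb; simp [α, evalWord, arc, n1, n2, n3]
    by_cases hyc : y = c
    · subst hyc; simp [α, evalWord, arc, n1, n2, n3]
    simp [α, evalWord, arc, hy, hyb, hyc]
  obtain ⟨β, hβ, hnd, e⟩ := h.exists_nodup (v := α) (by simp [α, IsWord, hba, hcb, hac]) (by simp [α])
  obtain ⟨y, hay, hy⟩ := exists_adj_of_moved hs hβ hnd (x := a) (by rw [e, ea]; exact n3)
  have hya : y ≠ a := by rintro rfl; exact hs _ hay
  rw [e, ea, ef y hya, or_self] at hy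
  exact hy ▸ hay

theorem HasShortWords.symmetricInComponents (hs : IsSimple D) (h : HasShortWords D) :
    SymmetricInComponents D := by
  intro u v huv hvu
  rcases (h.edgeStar hs).reach_le_two hvu with rfl | h1 | ⟨-, -, m, hvm, hmu⟩
  · exact huv
  · exact h1
  · exact h.adj_of_three_cycle hs hvm hmu huv

theorem HasShortWords.outNeighbour_of_triangle (hs : IsSimple D) (h : HasShortWords D) {a b c w : V}
    (hba : D.Adj b a) (hcb : D.Adj c b) (hac : D.Adj a c) (haw : D.Adj a w) :
    w = a ∨ w = b ∨ w = c := by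
  by_contra! hcon
  obtain ⟨hwa, hwb, hwc⟩ := hcon
  have n1 : a ≠ c := by rintro rfl; exact hs _ hac
  have n2 : c ≠ b := by rintro rfl; exact hs _ hcb
  have n3 : b ≠ a := by rintro rfl; exact hs _ hba
  -- Sending `a` to `w` frees a place through which `b` and `c` can be swapped.
  set α : List (V × V) := [(a, w), (b, a), (c, b), (a, c)] with hα
  have ea : evalWord α a = w := by simp [α, evalWord, arc, hwa, hwb, hwc]
  have eb : evalWord α b = c := by simp [α, evalWord, arc, n1, n3]
  have ec : evalWord α c = b := by simp [α, evalWord, arc, n1.symm, n2, n3]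
  have ef : ∀ y, y ≠ a → y ≠ b → y ≠ c → evalWord α y = y := by
    intro y h1 h2 h3; simp [α, evalWord, arc, h1, h2, h3]
  obtain ⟨β, hβ, hnd, e⟩ := h.exists_nodup (v := α) (by simp [α, IsWord, hba, hcb, hac, haw])
    (by simp [α])
  refine not_swap_of_nodup hs hβ hnd n2.symm ?_ ?_ (by rw [e, eb]) (by rw [e, ec])
  · intro y hy
    rw [e] at hy
    by_contra hyb
    by_cases hya : y = a
    · rw [hya, ea] at hy; exact hwc hy
    by_cases hyc : y = c
    · rw [hyc, ec] at hy; exact n2 hy.symm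
    rw [ef y hya hyb hyc] at hy
    exact hyc hy
  · intro y hy
    rw [e] at hy
    by_contra hyc
    by_cases hya : y = a
    · rw [hya, ea] at hy; exact hwb hy
    by_cases hyb : y = b
    · rw [hyb, eb] at hy; exact n2 hy
    rw [ef y hya hyb hyc] at hy
    exact hyb hy

/-- If `a` and `c` are adjacent, the three points form a complete triangle and any of them can be
the freed one. Otherwise the path realises distance two in both directions and `EdgeStar` applies.
-/
theorem HasShortWords.outNeighbour_of_path (hs : IsSimple D) (h : HasShortWords D) {a b c : V}
    (hab : D.Adj a b) (hba : D.Adj b a) (hbc : D.Adj b c) (hcb : D.Adj c b) (hac : a ≠ c)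
    {x y : V} (hx : x = a ∨ x = b ∨ x = c) (hxy : D.Adj x y) : y = a ∨ y = b ∨ y = c := by
  have hsym := h.symmetricInComponents hs
  have hst := h.edgeStar hs
  by_cases h1 : D.Adj a c
  · have h2 : D.Adj c a := hsym a c h1 ((Relation.ReflTransGen.single hcb).tail hba)
    rcases hx with rfl | rfl | rfl
    · exact h.outNeighbour_of_triangle hs hba hcb h1 hxy
    · have := h.outNeighbour_of_triangle hs hab h2 hbc hxy
      tauto
    · have := h.outNeighbour_of_triangle hs hbc hab h2 hxy
      tauto
  · have h2 : ¬ D.Adj c a := fun h2 => h1 (hsym c a h2 ((Relation.ReflTransGen.single hab).tail hbc))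
    rcases hx with rfl | rfl | rfl
    · have := hst c b x y hcb hba hac.symm h2 (Or.inr hxy)
      tauto
    · exact hst a x c y hab hbc hac h1 (Or.inl hxy)
    · exact hst a b x y hab hbc hac h1 (Or.inr hxy)

omit [DecidableEq V] in
-- Distances from `v` are at most two: either two points are out-neighbours of `v`, which becomes
-- the centre, or a point at distance two supplies the path.
theorem exists_path_of_two_lt_ncard (hst : EdgeStar D) {C : Set V} (hC : IsStrongComponent D C)
    (h : 2 < C.ncard) : ∃ a ∈ C, ∃ b ∈ C, ∃ c ∈ C, a ≠ c ∧
      ((D.Adj a b ∧ D.Adj b c) ∨ (D.Adj b a ∧ D.Adj b c)) := by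
  obtain ⟨v, c, d, hv, hc, hd, hvc, hvd, hcd⟩ := (Set.two_lt_ncard_iff (Set.finite_of_ncard_pos
    (by omega))).1 h
  have two : ∀ x ∈ C, v ≠ x → D.Adj v x ∨ ∃ m ∈ C, D.Adj v m ∧ D.Adj m x := by
    intro x hx hne
    rcases hst.reach_le_two (hC.reach hv hx) with h1 | h1 | ⟨-, -, m, hvm, hmx⟩
    · exact absurd h1 hne
    · exact Or.inl h1
    · exact Or.inr ⟨m, hC.mem_of_reach hv (.single hvm) ((Relation.ReflTransGen.single hmx).trans
        (hC.reach hx hv)), hvm, hmx⟩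
  rcases two c hc hvc with h1 | ⟨m, hm, h1, h2⟩
  · rcases two d hd hvd with h3 | ⟨m, hm, h3, h4⟩
    · exact ⟨c, hc, v, hv, d, hd, hcd, Or.inr ⟨h1, h3⟩⟩
    · exact ⟨v, hv, m, hm, d, hd, hvd, Or.inl ⟨h3, h4⟩⟩
  · exact ⟨v, hv, m, hm, c, hc, hvc, Or.inl ⟨h1, h2⟩⟩

theorem HasShortWords.starStar (hs : IsSimple D) (h : HasShortWords D) : StarStar D := by
  intro C hC
  have hsym := h.symmetricInComponents hs
  have key : 2 < C.ncard → C.ncard ≤ 3 ∧ IsTerminal D C := by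
    intro hcard
    obtain ⟨a, ha, b, hb, c, hc, hac, hadj⟩ := exists_path_of_two_lt_ncard (h.edgeStar hs) hC hcard
    have symC : ∀ {x y}, x ∈ C → y ∈ C → D.Adj x y → D.Adj y x := fun hx hy hxy =>
      hsym _ _ hxy (hC.reach hy hx)
    have hab : D.Adj a b := hadj.elim And.left fun h => symC hb ha h.1
    have hbc : D.Adj b c := hadj.elim And.right And.right
    have out : ∀ {x y}, (x = a ∨ x = b ∨ x = c) → D.Adj x y → (y = a ∨ y = b ∨ y = c) :=
      fun hx hxy => h.outNeighbour_of_path hs hab (symC ha hb hab) hbc (symC hb hc hbc) hac hx hxy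
    have hsub : ∀ x ∈ C, x = a ∨ x = b ∨ x = c := by
      intro x hx
      have hr := hC.reach ha hx
      induction hr with
      | refl => exact Or.inl rfl
      | tail hy hyz ih =>
        exact out (ih (hC.mem_of_reach ha hy ((Relation.ReflTransGen.single hyz).trans
          (hC.reach hx ha)))) hyz
    constructor
    · have h1 : C ⊆ (({a, b, c} : Finset V) : Set V) := fun x hx => by simpa using hsub x hx
      have h2 := Set.ncard_le_ncard h1
      rw [Set.ncard_coe_finset] at h2
      exact h2.trans Finset.card_le_three
    · rintro ⟨C', hC', hne, u, hu, v, hv, huv⟩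
      refine hne (hC'.eq_of_mem hC hv ?_)
      rcases out (hsub u hu) huv with rfl | rfl | rfl
      exacts [ha, hb, hc]
  refine ⟨fun hT => ?_, fun _ => ?_⟩
  · by_contra! hcon
    exact hT (key hcon).2
  · by_contra! hcon
    have := (key (by omega)).1
    omega

end Necessity

/-! ### The structure provides short words -/

section Sufficiency

variable {V : Type*} [DecidableEq V] {D : Digraph V}

theorem reach_evalWord {w : List (V × V)} (hw : IsWord D w) (x : V) :
    Relation.ReflTransGen D.Adj x (evalWord w x) := by
  induction w generalizing x with
  | nil => exact .refl
  | cons e w ih =>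
    have ih' := ih (fun f hf => hw f (by simp [hf]))
    rw [evalWord_cons]
    by_cases h : x = e.1
    · subst h
      rw [arc_self]
      exact (Relation.ReflTransGen.single (hw e (by simp))).trans (ih' _)
    · rw [arc_of_ne h]
      exact ih' x

/-- If a point is sent to distance two, then so is some intermediate point; and if an intermediate
point is sent to the end of a path realising distance two, then this end is fixed. -/
def RespectsDistTwo (D : Digraph V) (α : V → V) : Prop :=
  (∀ x, x ≠ α x → ¬ D.Adj x (α x) → ∃ m, D.Adj x m ∧ D.Adj m (α x) ∧ α m = α x) ∧
  (∀ x m, D.Adj x m → D.Adj m (α m) → x ≠ α m → ¬ D.Adj x (α m) → α (α m) = α m)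

/-- Induction on the word, prefixing a letter `(a, b)`. Where this letter interferes with a path
realising distance two, `EdgeStar` leaves only a few possibilities for its target or for the image.
-/
theorem respectsDistTwo_evalWord (hs : IsSimple D) (hst : EdgeStar D)
    (hsym : SymmetricInComponents D) {w : List (V × V)} (hw : IsWord D w) :
    RespectsDistTwo D (evalWord w) := by
  induction w with
  | nil => exact ⟨fun x hx => absurd rfl hx, fun x m _ _ _ _ => rfl⟩
  | cons e w ih =>
    obtain ⟨a, b⟩ := e
    have hw' : IsWord D w := fun f hf => hw f (by simp [hf])
    have hab : D.Adj a b := hw (a, b) (by simp)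
    obtain ⟨hA, hB⟩ := ih hw'
    have ea : evalWord ((a, b) :: w) a = evalWord w b := by rw [evalWord_cons, arc_self]
    have en : ∀ {y}, y ≠ a → evalWord ((a, b) :: w) y = evalWord w y := by
      intro y hy; rw [evalWord_cons, arc_of_ne hy]
    constructor
    · intro x hx hn
      by_cases hxa : x = a
      · subst hxa
        rw [ea] at hx hn ⊢
        have hr : Relation.ReflTransGen D.Adj x (evalWord w b) :=
          (Relation.ReflTransGen.single hab).trans (reach_evalWord hw' b)
        have hbx : b ≠ x := by rintro rfl; exact hs _ hab
        have hbz : b ≠ evalWord w b := by intro h; rw [← h] at hn; exact hn hab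
        by_cases hbz' : D.Adj b (evalWord w b)
        · exact ⟨b, hab, hbz', en hbx⟩
        · obtain ⟨m, hbm, hmz, em⟩ := hA b hbz hbz'
          have hmx : m ≠ x := by rintro rfl; exact hn hmz
          refine ⟨m, ?_, hmz, by rw [en hmx, em]⟩
          by_contra hxm
          rcases hst x b m (evalWord w b) hab hbm hmx.symm hxm (Or.inr hmz) with h | h | h
          · exact hx h.symm
          · exact hbz h.symm
          · rw [h] at hmz; exact hs _ hmz
      · rw [en hxa] at hx hn ⊢
        obtain ⟨m, hxm, hmz, em⟩ := hA x hx hn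
        refine ⟨m, hxm, hmz, ?_⟩
        by_cases hma : m = a
        · subst hma
          rw [ea]
          rcases hst x m _ b hxm hmz hx hn (Or.inl hab) with h | h | h
          · rw [h]
          · rw [h, em]
          · have := hB x m hxm (by rwa [em]) (by rwa [em]) (by rwa [em])
            rw [h, ← em, this]
        · rw [en hma, em]
    · intro x m hxm hmz hx hn
      have hmx : m ≠ x := by rintro rfl; exact hs _ hxm
      by_cases hma : m = a
      · subst hma
        rw [ea] at hmz hx hn ⊢
        have hzm : evalWord w b ≠ m := by intro h; rw [h] at hmz; exact hs _ hmz
        rw [en hzm]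
        rcases hst x m _ b hxm hmz hx hn (Or.inl hab) with h | h | h
        · subst h
          obtain ⟨m', h1, h2, h3⟩ := hA b hx hn
          have := hB b m' h1 (by rwa [h3]) (by rwa [h3]) (by rwa [h3])
          rwa [h3] at this
        · rw [h] at hab; exact absurd hab (hs _)
        · rw [← h, ← h]
      · rw [en hma] at hmz hx hn ⊢
        have hz := hB x m hxm hmz hx hn
        by_cases hza : evalWord w m = a
        · rw [hza] at hmz hx hn hz ⊢
          rw [ea]
          rcases hst x m a b hxm hmz hx hn (Or.inr hab) with h | h | h
          · subst h
            -- Here `b = x`, so the edge from `a` closes the triangle `x, m, a`, and symmetry gives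
            -- the missing edge from `x` to `a`.
            exact absurd (hsym a b hab ((Relation.ReflTransGen.single hxm).tail hmz)) hn
          · rw [h, hza]
          · rw [h] at hab; exact absurd hab (hs _)
        · rw [en hza, hz]

/-- A word that maps a strong component injectively to itself fixes it pointwise. -/
theorem evalWord_eq_self_of_injOn {C : Set V} (hC : IsStrongComponent D C) {w : List (V × V)}
    (hw : IsWord D w) (hm : Set.MapsTo (evalWord w) C C) (hi : Set.InjOn (evalWord w) C) {x : V}
    (hx : x ∈ C) : evalWord w x = x := by
  induction w with
  | nil => rfl
  | cons e w ih =>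
    obtain ⟨a, b⟩ := e
    have hw' : IsWord D w := fun f hf => hw f (by simp [hf])
    have hab : D.Adj a b := hw (a, b) (by simp)
    have ea : evalWord ((a, b) :: w) a = evalWord w b := by rw [evalWord_cons, arc_self]
    have en : ∀ {y}, y ≠ a → evalWord ((a, b) :: w) y = evalWord w y := by
      intro y hy; rw [evalWord_cons, arc_of_ne hy]
    by_cases haC : a ∈ C
    · have h1 : evalWord w b ∈ C := ea ▸ hm haC
      have hbC : b ∈ C := hC.mem_of_reach haC (.single hab)
        ((reach_evalWord hw' b).trans (hC.reach h1 haC))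
      by_cases hba : b = a
      · subst hba
        have ee : ∀ y, evalWord ((b, b) :: w) y = evalWord w y := fun y => by
          by_cases hy : y = b
          · rw [hy, ea]
          · exact en hy
        rw [ee]
        exact ih hw' (fun y hy => ee y ▸ hm hy) (fun y hy z hz h => hi hy hz (by rw [ee, ee, h]))
      -- The first letter would merge `a` and `b`, both in `C`.
      · exact absurd (hi hbC haC (by rw [ea, en hba])) hba
    · have ee : ∀ y ∈ C, evalWord ((a, b) :: w) y = evalWord w y := fun y hy =>
        en (by rintro rfl; exact haC hy)
      rw [ee x hx]
      exact ih hw' (fun y hy => ee y hy ▸ hm hy)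
        (fun y hy z hz h => hi hy hz (by rw [ee y hy, ee z hz, h]))

/-- A transformation moving points along edges only, and without cycles among the moved points,
is expressed by a word with one letter for each moved point. -/
theorem exists_word_of_acyclic [Finite V] (γ : V → V) (hadj : ∀ x, γ x ≠ x → D.Adj x (γ x))
    (hac : ∀ S : Set V, S.Nonempty → (∀ x ∈ S, γ x ≠ x) → ∃ x ∈ S, γ x ∉ S) :
    ∃ w, IsWord D w ∧ evalWord w = γ ∧ w.length = {x | γ x ≠ x}.ncard := by
  induction hk : {x | γ x ≠ x}.ncard generalizing γ with
  | zero =>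
    rw [Set.ncard_eq_zero] at hk
    refine ⟨[], by simp [IsWord], ?_, rfl⟩
    funext x
    by_contra hx
    have : x ∈ {x | γ x ≠ x} := fun h => hx h.symm
    rw [hk] at this
    exact this
  | succ k ih =>
    -- Acyclicity gives a moved `x` with fixed image. Its letter goes first, as the remaining word
    -- then leaves `γ x` in place.
    obtain ⟨x, hx, hγx⟩ := hac {x | γ x ≠ x} (Set.nonempty_of_ncard_ne_zero (by omega))
      (fun _ h => h)
    have hx' : γ x ≠ x := hx
    have hγx' : γ (γ x) = γ x := by simpa using hγx
    have em : {y | Function.update γ x x y ≠ y} = {y | γ y ≠ y} \ {x} := by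
      ext y
      by_cases hy : y = x
      · simp [hy]
      · simp [hy]
    obtain ⟨w, hw, e, hl⟩ := ih (Function.update γ x x) (by
        intro y hy
        have hyx : y ≠ x := by rintro rfl; simp at hy
        rw [Function.update_of_ne hyx] at hy ⊢
        exact hadj y hy) (by
        intro S hS hmv
        have hne : ∀ y ∈ S, y ≠ x := by
          rintro y hy rfl
          simpa using hmv y hy
        obtain ⟨y, hy, hy'⟩ := hac S hS (fun y hy => by
          have := hmv y hy
          rwa [Function.update_of_ne (hne y hy)] at this)
        exact ⟨y, hy, by rwa [Function.update_of_ne (hne y hy)]⟩) (by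
        rw [em, Set.ncard_sdiff_singleton_of_mem hx, hk, Nat.add_sub_cancel])
    refine ⟨(x, γ x) :: w, ?_, ?_, by simp [hl]⟩
    · intro f hf
      rcases List.mem_cons.1 hf with rfl | hf
      · exact hadj x hx'
      · exact hw f hf
    · funext y
      rw [evalWord_cons, e]
      by_cases hy : y = x
      · rw [hy, arc_self, Function.update_of_ne hx', hγx']
      · rw [arc_of_ne hy, Function.update_of_ne hy]

omit [DecidableEq V] in
theorem exists_periodic_mem [Finite V] {γ : V → V} {S : Set V} (hS : S.Nonempty)
    (hm : Set.MapsTo γ S S) : ∃ x ∈ S, x ∈ Function.periodicPts γ := by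
  obtain ⟨x, hx⟩ := hS
  obtain ⟨i, j, hij, he⟩ := Finite.exists_ne_map_eq_of_infinite (fun i : ℕ => γ^[i] x)
  have key : ∀ i j, i < j → γ^[i] x = γ^[j] x → γ^[i] x ∈ Function.periodicPts γ := by
    intro i j hij he
    refine ⟨j - i, by omega, ?_⟩
    rw [Function.IsPeriodicPt, Function.IsFixedPt, ← Function.iterate_add_apply,
      Nat.sub_add_cancel hij.le, he]
  rcases lt_or_gt_of_ne hij with h | h
  · exact ⟨_, hm.iterate i hx, key i j h he⟩
  · exact ⟨_, hm.iterate j hx, key j i h he.symm⟩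

omit [DecidableEq V] in
theorem eq_insert_of_ncard_le_three [Finite V] {C : Set V} (hC : C.ncard ≤ 3) {x y z : V}
    (hx : x ∈ C) (hy : y ∈ C) (hz : z ∈ C) (hxy : x ≠ y) (hxz : x ≠ z) (hyz : y ≠ z) :
    ∀ t ∈ C, t = x ∨ t = y ∨ t = z := by
  have h : ({x, y, z} : Set V) = C := by
    refine Set.eq_of_subset_of_ncard_le ?_ ?_
    · rintro t (rfl | rfl | rfl) <;> assumption
    · rwa [Set.ncard_eq_three.2 ⟨x, y, z, hxy, hxz, hyz, rfl⟩]
  intro t ht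
  rw [← h] at ht
  simpa using ht

/-- A moved point that should first be merged with another point having the same image: its image
is not adjacent to it, or it is swapped with its image. -/
def IsDetour (D : Digraph V) (α : V → V) (x : V) : Prop :=
  α x ≠ x ∧ (¬ D.Adj x (α x) ∨ (α (α x) = x ∧ ∃ m, D.Adj x m ∧ D.Adj m (α x) ∧ α m = α x))

omit [DecidableEq V] in
-- The middle point `m` has an edge to its image, so it could be a detour only if swapped with it.
-- But `α (α x)` is `α x` in the distance-two case and `x` in the swap case, never `m`.
theorem IsDetour.exists_middle (hs : IsSimple D) {α : V → V} (hα : RespectsDistTwo D α) {x : V}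
    (hx : IsDetour D α x) : ∃ m, D.Adj x m ∧ α m = α x ∧ ¬ IsDetour D α m := by
  have key : ∀ m, D.Adj x m → D.Adj m (α x) → α m = α x → α (α x) ≠ m →
      D.Adj x m ∧ α m = α x ∧ ¬ IsDetour D α m := by
    intro m h1 h2 h3 h4
    refine ⟨h1, h3, ?_⟩
    rintro ⟨-, h | ⟨h, -⟩⟩
    · rw [h3] at h; exact h h2
    · rw [h3] at h; exact h4 h
  obtain ⟨h1, h2 | ⟨h2, m, h3, h4, h5⟩⟩ := hx
  · obtain ⟨m, h3, h4, h5⟩ := hα.1 x h1.symm h2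
    refine ⟨m, key m h3 h4 h5 ?_⟩
    have := hα.2 x m h3 (by rwa [h5]) (by rw [h5]; exact h1.symm) (by rwa [h5])
    rw [h5] at this
    rw [this]
    rintro h
    rw [h] at h4
    exact hs _ h4
  · refine ⟨m, key m h3 h4 h5 ?_⟩
    rw [h2]
    rintro rfl
    exact hs _ h3

omit [DecidableEq V] in
/-- In a strong component `{a, b, c}`, if `a` and `b` are swapped and `c` is mapped to `a`, then
the component is complete and `b` can be merged with `c`. -/
theorem isDetour_of_swap (hsym : SymmetricInComponents D) {α : V → V} (hα : RespectsDistTwo D α)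
    {a b c : V} (hab : D.Adj a b) (hca : c ≠ a) (hcb : c ≠ b)
    (ea : α a = b) (eb : α b = a) (ec : α c = a) (hne : a ≠ b)
    (hbc : Relation.ReflTransGen D.Adj b c) : IsDetour D α b := by
  -- A missing edge from `c` to `a`, or below to `b`, would make that vertex a fixed point by the
  -- second clause of `RespectsDistTwo`.
  have h1 : D.Adj c a := by
    by_contra h1
    obtain ⟨m, h2, h3, h4⟩ := hα.1 c (by rwa [ec]) (by rwa [ec])
    rw [ec] at h3 h4
    have := hα.2 c m h2 (by rwa [h4]) (by rwa [h4]) (by rwa [h4])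
    rw [h4, ea] at this
    exact hne this.symm
  have h2 : D.Adj c b := by
    by_contra h2
    have := hα.2 c a h1 (by rwa [ea]) (by rwa [ea]) (by rwa [ea])
    rw [ea, eb] at this
    exact hne this
  refine ⟨by rwa [eb], Or.inr ⟨by rw [eb, ea], c, hsym c b h2 hbc, by rwa [eb], by rw [ec, eb]⟩⟩

theorem exists_notMem_of_not_isDetour [Finite V] (hsym : SymmetricInComponents D)
    (hss : StarStar D) {w : List (V × V)} (hw : IsWord D w) (hα : RespectsDistTwo D (evalWord w))
    {S : Set V} (hS : S.Nonempty) (hmv : ∀ x ∈ S, evalWord w x ≠ x ∧ ¬ IsDetour D (evalWord w) x) :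
    ∃ x ∈ S, evalWord w x ∉ S := by
  by_contra! hcon
  set α := evalWord w with hαdef
  have hreach : ∀ x, Relation.ReflTransGen D.Adj x (α x) := reach_evalWord hw
  have hadj : ∀ x ∈ S, D.Adj x (α x) := fun x hx => by
    by_contra h
    exact (hmv x hx).2 ⟨(hmv x hx).1, Or.inl h⟩
  obtain ⟨y, hyS, hyp⟩ := exists_periodic_mem hS hcon
  set P : Set V := Function.periodicPts α with hP
  have hbij : Set.BijOn α P P := Function.bijOn_periodicPts α
  have hback : ∀ x ∈ P, Relation.ReflTransGen D.Adj (α x) x := by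
    rintro x ⟨k, hk, hx⟩
    have hit : ∀ i z, Relation.ReflTransGen D.Adj z (α^[i] z) := by
      intro i
      induction i with
      | zero => exact fun z => .refl
      | succ i ih => exact fun z => (hreach z).trans (ih _)
    obtain ⟨j, rfl⟩ := Nat.exists_eq_succ_of_ne_zero hk.ne'
    have hx' : α^[j] (α x) = x := hx
    have := hit j (α x)
    rwa [hx'] at this
  set C : Set V := {u | Relation.ReflTransGen D.Adj y u ∧ Relation.ReflTransGen D.Adj u y} with hCdef
  have hC : IsStrongComponent D C := ⟨y, rfl⟩
  have hyC : y ∈ C := ⟨.refl, .refl⟩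
  have hmC : ∀ x ∈ C, x ∈ P → α x ∈ C := fun x hx hxP =>
    hC.mem_of_reach hx (hreach x) (hback x hxP)
  -- If all of `C` were periodic, `α` would permute `C` and hence fix it pointwise.
  have hCP : ¬ C ⊆ P := fun h => (hmv y hyS).1
    (evalWord_eq_self_of_injOn hC hw (fun x hx => hmC x hx (h hx)) (hbij.injOn.mono h) hyC)
  have hcard : C.ncard ≤ 3 := by
    by_cases hT : IsTerminal D C
    · exact (hss C hC).2 hT
    · exact ((hss C hC).1 hT).trans (by norm_num)
  have h1P : α y ∈ P := hbij.mapsTo hyp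
  have h1C : α y ∈ C := hmC y hyC hyp
  have h1S : α y ∈ S := hcon y hyS
  have hy1 : y ≠ α y := (hmv y hyS).1.symm
  by_cases h2 : α (α y) = y
  swap
  -- A cycle with at least three points would exhaust `C`.
  · have h3 := eq_insert_of_ncard_le_three hcard hyC h1C (hmC _ h1C h1P) hy1 (Ne.symm h2)
      (hmv _ h1S).1.symm
    refine hCP fun t ht => ?_
    rcases h3 t ht with rfl | rfl | rfl
    exacts [hyp, h1P, hbij.mapsTo h1P]
  obtain ⟨c, hcC, hcP⟩ := Set.not_subset.1 hCP
  have hcy : c ≠ y := by rintro rfl; exact hcP hyp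
  have hc1 : c ≠ α y := by intro h; exact hcP (h ▸ h1P)
  have hmem := eq_insert_of_ncard_le_three hcard hyC h1C hcC hy1 hcy.symm hc1.symm
  -- The swapped pair and `c` are three points, too many for a nonterminal component. Hence `c`
  -- stays in `C`, and not being periodic it maps onto one of the pair.
  have hT : IsTerminal D C := by
    by_contra hT
    have := (hss C hC).1 hT
    have h3 := (Set.two_lt_ncard_iff (Set.toFinite C)).2
      ⟨y, α y, c, hyC, h1C, hcC, hy1, hcy.symm, hc1.symm⟩
    omega
  have hadj1 := hadj y hyS
  have hadj2 := hadj _ h1S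
  rw [h2] at hadj2
  rcases hmem _ (hT.mem_of_reach hcC (hreach c)) with h | h | h
  · exact (hmv _ h1S).2 (isDetour_of_swap hsym hα hadj1 hcy hc1 rfl h2 h hy1
      (hC.reach h1C hcC))
  · exact (hmv y hyS).2 (isDetour_of_swap hsym hα hadj2 hc1 hcy h2 rfl h hy1.symm
      (hC.reach hyC hcC))
  · exact hcP ⟨1, one_pos, h⟩

open Classical in
theorem hasShortWords_of_structure [Finite V] (hs : IsSimple D) (hst : EdgeStar D)
    (hsym : SymmetricInComponents D) (hss : StarStar D) : HasShortWords D := by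
  intro α hα
  obtain ⟨w, hw, rfl⟩ := exists_word hα
  have hr := respectsDistTwo_evalWord hs hst hsym hw
  set α := evalWord w with hαdef
  choose! mid hmid hmidα hmidD using fun x (hx : IsDetour D α x) => hx.exists_middle hs hr
  -- `δ` merges each detour into its middle point; `ν` then makes the direct moves. They move
  -- disjoint sets of points, so the lengths add up. As middle points are not detours, `δ` has no
  -- cycles.
  set δ : V → V := fun x => if IsDetour D α x then mid x else x with hδ
  set ν : V → V := fun x => if IsDetour D α x then x else α x with hν
  have hδm : ∀ x, δ x ≠ x ↔ IsDetour D α x := by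
    intro x
    by_cases hx : IsDetour D α x
    · simp only [hδ, hx, if_true, iff_true]
      intro h
      have := hmid x hx
      rw [h] at this
      exact hs _ this
    · simp [hδ, hx]
  have hνm : ∀ x, ν x ≠ x ↔ α x ≠ x ∧ ¬ IsDetour D α x := by
    intro x
    by_cases hx : IsDetour D α x <;> simp [hν, hx]
  obtain ⟨u, hu, eu, lu⟩ := exists_word_of_acyclic (D := D) δ
    (fun x hx => by
      have hx' := (hδm x).1 hx
      simp only [hδ, hx', if_true]
      exact hmid x hx')
    (fun S ⟨x, hx⟩ hS => by
      have hx' := (hδm x).1 (hS x hx)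
      refine ⟨x, hx, fun h => hmidD x hx' ?_⟩
      have := (hδm _).1 (hS _ h)
      simpa only [hδ, hx', if_true] using this)
  obtain ⟨v, hv, ev, lv⟩ := exists_word_of_acyclic (D := D) ν
    (fun x hx => by
      obtain ⟨h1, h2⟩ := (hνm x).1 hx
      simp only [hν, h2, if_false]
      by_contra h3
      exact h2 ⟨h1, Or.inl h3⟩)
    (fun S hS hmv => by
      obtain ⟨x, hx, hx'⟩ := exists_notMem_of_not_isDetour hsym hss hw hr hS
        (fun x hx => (hνm x).1 (hmv x hx))
      refine ⟨x, hx, ?_⟩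
      simpa only [hν, ((hνm x).1 (hmv x hx)).2, if_false] using hx')
  refine ⟨u ++ v, ?_, ?_, ?_⟩
  · intro e he
    rcases List.mem_append.1 he with h | h
    exacts [hu e h, hv e h]
  · funext x
    rw [evalWord_append, eu, ev]
    by_cases hx : IsDetour D α x
    · simp only [hδ, hν, hx, if_true, hmidD x hx, if_false, hmidα x hx]
    · simp only [hδ, hν, hx, if_false]
  · rw [List.length_append, lu, lv, ← Set.ncard_union_eq]
    · congr 1
      ext x
      have := fun h : IsDetour D α x => h.1
      simp only [Set.mem_union, Set.mem_ofPred_eq, hδm, hνm]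
      tauto
    · rw [Set.disjoint_left]
      intro x h1 h2
      exact ((hνm x).1 h2).2 ((hδm x).1 h1)

end Sufficiency

end ArcSemigroup

theorem mainTheorem2 (n : ℕ) (D : Digraph (Fin n)) (hs : ArcSemigroup.IsSimple D)
    (hc : ArcSemigroup.IsConnected D) :
    (∀ α ∈ ArcSemigroup.arcSemigroup D,
      (ArcSemigroup.wordLength D α : ℤ) = (n : ℤ) - (ArcSemigroup.fix α : ℤ)) ↔
    (ArcSemigroup.IsClosed D ∧ ArcSemigroup.Star D ∧ ArcSemigroup.StarStar D) := by
  have h := ArcSemigroup.wordLength_eq_iff D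
  rw [Fintype.card_fin] at h
  rw [h, ArcSemigroup.star_iff_edgeStar hs]
  constructor
  · intro h
    exact ⟨(h.symmetricInComponents hs).isClosed, h.edgeStar hs, h.starStar hs⟩
  · rintro ⟨h1, h2, h3⟩
    exact ArcSemigroup.hasShortWords_of_structure hs h2 (h1.symmetricInComponents hs h2) h3
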